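/- Let $d\ge 1$, let $\mathbb N=\{1,2,\dots\}$ and let $\mathcal H=\ell^2(\mathbb N,\mathbb C^d)$. For sequences $(a_x)_{x\ge1},(s_x)_{x\ge 1},(b_x)_{x\ge1}$ of complex $d\times d$ matrices, put $a_0=\mathbf 1$ and let $$(H_oy)_x=y_{x-1}+y_{x+1},\qquad (V_cy)_x=(a_{x-1}-\mathbf 1)y_{x-1}+b_xy_x+(s_x-\mathbf 1)y_{x+1},\qquad x\in\mathbb N,\ y_0=0 .$$ For $p\ge1$ and $q\in\{2p-1,2p\}$ let $\mathbb J_q^c$ be the class of operators $V_c$ such that all $a_x,s_x$ are invertible, $a_x=s_x=\mathbf 1$ and $b_x=0$ for $x>p$, and moreover: if $q=2p-1$, then $a_p=s_p=\mathbf 1$ and $b_p$ is invertible; if $q=2p$, then $\mathbf 1-s_pa_p$ is invertible. Let $\mathbb J_q\subset\mathbb J_q^c$ be the subclass with $a_x=s_x>0$ (positive definite) and $b_x=b_x^*$ for all $x\ge1$. Let $V_c\in\mathbb J_q^c$. There is a unique sequence $(f_x)_{x\ge0}$ of matrix-valued polynomials in $k$ (the Jost solution) such that $a_{x-1}f_{x-1}(k)+b_xf_x(k)+s_xf_{x+1}(k)=(k+k^{-1})f_x(k)$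 for all $x\ge1$, $k\in\mathbb C\setminus\{0\}$, and $f_x(k)=k^x\mathbf 1$ for all $x>p$. Let $\phi(k)=\det f_0(k)$ be the Jost determinant and let $\mathcal T_p=a_1^{-1}a_2^{-1}\cdots a_p^{-1}$. For $0<|k|<1$ and $\lambda(k)=k+k^{-1}$, the operator $H_o-\lambda(k)$ is invertible and, with $R_o(\lambda)=(H_o-\lambda)^{-1}$, the operator $V_cR_o(\lambda(k))$ has finite rank. Put $$D_c(k)=\det\bigl(I+V_cR_o(\lambda(k))\bigr)\quad(0<|k|<1),\qquad D_c(0)=1,$$ the latter corresponding to $\lambda(0)=\infty$, $R_o(\infty)=0$. Then $$\phi(k)=D_c(k)\det\mathcal T_p\qquad\text{for all } |k|<1 .$$ The function $D_c$ is the restriction to the unit disc of a polynomial, and with this polynomial in place of $D_c$ the identity holds for all $k\in\mathbb C$. If moreover $V_c\in\mathbb J_q$, then $\phi$ is real on $\mathbb R$, and the resonances (the zeros of $\phi$ in $\{|k|>1\}$ together with those at $k=\pm1$) are symmetric with respect to the real line; more precisely, for every $k\in\mathbb C$, the number $k$ is a resonance if and only if $\overline k$ is, and $k$ and $\overline k$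 have the same multiplicity as zeros of $\phi$. -/

import Mathlib

open Polynomial

noncomputable section

/-- The Hilbert space `ℓ²(ℕ, ℂ^d)`. The half-lattice `{1, 2, 3, …}` is indexed from zero:
the value of a sequence at the lattice site `x ≥ 1` is `y (x - 1)`, see `siteValue`. -/
abbrev LatticeSpace (d : ℕ) : Type := lp (fun _ : ℕ => EuclideanSpace ℂ (Fin d)) 2

/-- The value `y_x` of `y` at the site `x`, with the boundary convention `y_0 = 0`. -/
def siteValue {d : ℕ} (y : LatticeSpace d) : ℕ → EuclideanSpace ℂ (Fin d)
  | 0 => 0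
  | n + 1 => y n

theorem siteValue_add {d : ℕ} (y z : LatticeSpace d) (x : ℕ) :
    siteValue (y + z) x = siteValue y x + siteValue z x := by
  cases x <;> simp [siteValue]

theorem siteValue_smul {d : ℕ} (c : ℂ) (y : LatticeSpace d) (x : ℕ) :
    siteValue (c • y) x = c • siteValue y x := by
  cases x <;> simp [siteValue]

theorem continuous_siteValue {d : ℕ} (x : ℕ) :
    Continuous fun y : LatticeSpace d => siteValue y x := by
  cases x with
  | zero => exact continuous_const
  | succ n =>
    exact (lp.evalCLM ℂ (fun _ : ℕ => EuclideanSpace ℂ (Fin d)) 2 n).continuous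

theorem memlp_two_iff {d : ℕ} (u : ℕ → EuclideanSpace ℂ (Fin d)) :
    Memℓp u 2 ↔ Summable fun n => ‖u n‖ ^ 2 := by
  rw [memℓp_gen_iff (by norm_num)]
  simp

theorem lattice_norm_sq {d : ℕ} (y : LatticeSpace d) : ‖y‖ ^ 2 = ∑' n, ‖y n‖ ^ 2 := by
  have h := lp.norm_rpow_eq_tsum (p := 2) (by norm_num) y
  simpa using h

theorem summable_lattice {d : ℕ} (y : LatticeSpace d) : Summable fun n => ‖y n‖ ^ 2 :=
  (memlp_two_iff _).1 (lp.memℓp y)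

/-- The operator `(S y)_x = y_{x-1}`. -/
def shiftRight (d : ℕ) : LatticeSpace d →L[ℂ] LatticeSpace d :=
  LinearMap.mkContinuous
    { toFun := fun y => ⟨fun n => siteValue y n, (memlp_two_iff _).2
        ((summable_nat_add_iff 1).1 (by simpa [siteValue] using summable_lattice y))⟩
      map_add' := fun y z => by ext n : 2; exact siteValue_add y z n
      map_smul' := fun c y => by ext n : 2; exact siteValue_smul c y n } 1
    (fun y => by
      rw [one_mul]
      refine le_of_sq_le_sq ?_ (norm_nonneg _)
      rw [lattice_norm_sq, lattice_norm_sq]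
      refine le_of_eq ?_
      have hs : Summable fun n => ‖siteValue y n‖ ^ 2 :=
        (summable_nat_add_iff 1).1 (by simpa [siteValue] using summable_lattice y)
      change ∑' n, ‖siteValue y n‖ ^ 2 = _
      rw [hs.tsum_eq_zero_add]
      simp [siteValue])

/-- The operator `(S y)_x = y_{x+1}`. -/
def shiftLeft (d : ℕ) : LatticeSpace d →L[ℂ] LatticeSpace d :=
  LinearMap.mkContinuous
    { toFun := fun y => ⟨fun n => siteValue y (n + 2), (memlp_two_iff _).2
        ((summable_nat_add_iff 1).2 (summable_lattice y))⟩
      map_add' := fun y z => by ext n : 2; exact siteValue_add y z (n + 2)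
      map_smul' := fun c y => by ext n : 2; exact siteValue_smul c y (n + 2) } 1
    (fun y => by
      rw [one_mul]
      refine le_of_sq_le_sq ?_ (norm_nonneg _)
      rw [lattice_norm_sq, lattice_norm_sq]
      change ∑' n, ‖y (n + 1)‖ ^ 2 ≤ _
      rw [(summable_lattice y).tsum_eq_zero_add]
      exact le_add_of_nonneg_left (by positivity))

/-- The discrete Laplacian `(H_o y)_x = y_{x-1} + y_{x+1}` on the half-lattice. -/
def freeOp (d : ℕ) : LatticeSpace d →L[ℂ] LatticeSpace d := shiftRight d + shiftLeft d

theorem siteValue_freeOp {d : ℕ} (y : LatticeSpace d) (x : ℕ) :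
    siteValue (freeOp d y) (x + 1) = siteValue y x + siteValue y (x + 2) := rfl

/-- Finitely supported coefficients of a matrix-valued Jacobi operator. The coefficients with
index `x ≥ 1` are the data, `a_0 = 1` is a convention, and `s_0`, `b_0` are never used. -/
structure JacobiPerturbation (d : ℕ) where
  /-- the coefficients below the diagonal -/
  a : ℕ → Matrix (Fin d) (Fin d) ℂ
  /-- the coefficients above the diagonal -/
  s : ℕ → Matrix (Fin d) (Fin d) ℂ
  /-- the diagonal coefficients -/
  b : ℕ → Matrix (Fin d) (Fin d) ℂ
  a_zero : a 0 = 1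
  finite_support : ∃ N, ∀ x, N < x → a x = 1 ∧ s x = 1 ∧ b x = 0

namespace JacobiPerturbation

variable {d : ℕ} (V : JacobiPerturbation d)

/-- `(V_c y)_x = (a_{x-1} - 1) y_{x-1} + b_x y_x + (s_x - 1) y_{x+1}` at the site `x = n + 1`. -/
def opValue (y : LatticeSpace d) (n : ℕ) : EuclideanSpace ℂ (Fin d) :=
  (V.a n - 1).toEuclideanLin (siteValue y n) + (V.b (n + 1)).toEuclideanLin (siteValue y (n + 1))
    + (V.s (n + 1) - 1).toEuclideanLin (siteValue y (n + 2))

theorem exists_opValue_eq_zero : ∃ N, ∀ y n, N ≤ n → V.opValue y n = 0 := by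
  obtain ⟨N, hN⟩ := V.finite_support
  refine ⟨N + 1, fun y n hn => ?_⟩
  simp [opValue, hN n (by omega), hN (n + 1) (by omega)]

theorem continuous_opValue (n : ℕ) : Continuous fun y => V.opValue y n := by
  unfold opValue
  exact (((LinearMap.continuous_of_finiteDimensional _).comp (continuous_siteValue _)).add
    ((LinearMap.continuous_of_finiteDimensional _).comp (continuous_siteValue _))).add
    ((LinearMap.continuous_of_finiteDimensional _).comp (continuous_siteValue _))

/-- `V_c` as a linear map. -/
def opLin : LatticeSpace d →ₗ[ℂ] LatticeSpace d where
  toFun y := ⟨V.opValue y, (memlp_two_iff _).2 (by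
    obtain ⟨N, hN⟩ := V.exists_opValue_eq_zero
    refine summable_of_ne_finset_zero (s := Finset.range N) fun n hn => ?_
    rw [hN y n (by simpa using hn)]
    simp)⟩
  map_add' y z := by
    ext n : 2
    change V.opValue (y + z) n = V.opValue y n + V.opValue z n
    simp only [opValue, siteValue_add, map_add]
    abel
  map_smul' c y := by
    ext n : 2
    change V.opValue (c • y) n = c • V.opValue y n
    simp only [opValue, siteValue_smul, map_smul, smul_add]

/-- The bounded operator `V_c` on `ℓ²`. -/
def op : LatticeSpace d →L[ℂ] LatticeSpace d where
  toLinearMap := V.opLin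
  cont := by
    obtain ⟨N, hN⟩ := V.exists_opValue_eq_zero
    have h : ∀ y, V.opLin y = ∑ n ∈ Finset.range N,
        lp.singleContinuousLinearMap ℂ (fun _ : ℕ => EuclideanSpace ℂ (Fin d)) 2 n
          (V.opValue y n) := by
      intro y
      ext m : 2
      rw [lp.coeFn_sum, Finset.sum_apply]
      change V.opValue y m = _
      by_cases hm : m < N
      · rw [Finset.sum_eq_single m]
        · simp
        · intro n _ hnm
          simp [Ne.symm hnm]
        · intro h
          exact absurd (Finset.mem_range.2 hm) h
      · rw [hN y m (by omega), Finset.sum_eq_zero]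
        intro n hn
        have : m ≠ n := by
          have := Finset.mem_range.1 hn
          omega
        simp [this]
    have h' : (V.opLin : LatticeSpace d → LatticeSpace d) = fun y => ∑ n ∈ Finset.range N,
        lp.singleContinuousLinearMap ℂ (fun _ : ℕ => EuclideanSpace ℂ (Fin d)) 2 n
          (V.opValue y n) := funext h
    change Continuous (V.opLin : LatticeSpace d → LatticeSpace d)
    rw [h']
    exact continuous_finsetSum _ fun n _ =>
      (ContinuousLinearMap.continuous _).comp (V.continuous_opValue n)

theorem siteValue_op (y : LatticeSpace d) (x : ℕ) :
    siteValue (V.op y) (x + 1) = (V.a x - 1).toEuclideanLin (siteValue y x)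
      + (V.b (x + 1)).toEuclideanLin (siteValue y (x + 1))
      + (V.s (x + 1) - 1).toEuclideanLin (siteValue y (x + 2)) := rfl

/-- The class `J_q^c`, for `q = 2 p - 1` or `q = 2 p`. -/
structure MemJc (p q : ℕ) : Prop where
  det_a : ∀ x, 1 ≤ x → (V.a x).det ≠ 0
  det_s : ∀ x, 1 ≤ x → (V.s x).det ≠ 0
  support : ∀ x, p < x → V.a x = 1 ∧ V.s x = 1 ∧ V.b x = 0
  odd_case : q + 1 = 2 * p → V.a p = 1 ∧ V.s p = 1 ∧ (V.b p).det ≠ 0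
  even_case : q = 2 * p → (1 - V.s p * V.a p).det ≠ 0

open scoped ComplexOrder in
/-- The class `J_q` of self-adjoint perturbations. -/
structure MemJ (p q : ℕ) : Prop extends V.MemJc p q where
  a_eq_s : ∀ x, 1 ≤ x → V.a x = V.s x
  a_posDef : ∀ x, 1 ≤ x → (V.a x).PosDef
  b_hermitian : ∀ x, 1 ≤ x → (V.b x).IsHermitian

/-- The matrix `T_p = a_1⁻¹ a_2⁻¹ ⋯ a_p⁻¹`. -/
def invProd (p : ℕ) : Matrix (Fin d) (Fin d) ℂ :=
  ((List.range p).map fun j => (V.a (j + 1))⁻¹).prod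

/-- `f = (f_x)_{x ≥ 0}` is the Jost solution: the `f_x` are matrix-valued polynomials in `k` with
`a_{x-1} f_{x-1}(k) + s_x f_{x+1}(k) + b_x f_x(k) = (k + k⁻¹) f_x(k)` for `x ≥ 1`, `k ≠ 0`
(`x` is written `x + 1` below), and `f_x(k) = k^x` for `x > p`. -/
structure IsJostSolution (p : ℕ) (f : ℕ → Matrix (Fin d) (Fin d) ℂ[X]) : Prop where
  equation : ∀ k : ℂ, k ≠ 0 → ∀ x : ℕ,
    V.a x * (f x).map (eval k) + V.s (x + 1) * (f (x + 2)).map (eval k)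
      + V.b (x + 1) * (f (x + 1)).map (eval k) = (k + k⁻¹) • (f (x + 1)).map (eval k)
  eq_pow : ∀ x : ℕ, p < x → ∀ k : ℂ,
    (f x).map (eval k) = k ^ x • (1 : Matrix (Fin d) (Fin d) ℂ)

end JacobiPerturbation

/-- The determinant `det (I + A)` of a finite-rank operator `A`, that is, the determinant of
`I + A` on the invariant finite-dimensional subspace `ran A`. -/
def fredholmDet {E : Type*} [NormedAddCommGroup E] [NormedSpace ℂ E] (A : E →L[ℂ] E) : ℂ :=
  LinearMap.det (1 + (A : E →ₗ[ℂ] E).restrict (p := LinearMap.range (A : E →ₗ[ℂ] E))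
    (q := LinearMap.range (A : E →ₗ[ℂ] E)) fun x _ => LinearMap.mem_range_self _ x)

open Classical in
/-- The free resolvent `R_o(λ) = (H_o - λ)⁻¹` at `λ = k + k⁻¹`; the point `k = 0` corresponds
to `λ = ∞`, where the resolvent vanishes. -/
def freeResolvent (d : ℕ) (k : ℂ) : LatticeSpace d →L[ℂ] LatticeSpace d :=
  if k = 0 then 0 else Ring.inverse (freeOp d - (k + k⁻¹) • 1)

/-- The Fredholm determinant `D_c(k) = det (I + V_c R_o(λ(k)))`, for `k` in the unit disc. -/
def JacobiPerturbation.fredholmD {d : ℕ} (V : JacobiPerturbation d) (k : ℂ) : ℂ :=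
  fredholmDet (V.op ∘L freeResolvent d k)

/-- `k` is a resonance: a zero of the Jost determinant `φ` outside the closed unit disc, or
a zero at one of the points `±1`. -/
def IsResonance (φ : ℂ[X]) (k : ℂ) : Prop :=
  φ.eval k = 0 ∧ (1 < ‖k‖ ∨ k = 1 ∨ k = -1)

end

/-!
On sequences with `y_{p+2} = k y_{p+1}`, the operator `-k (H_o + V_c - λ(k))` acts on the sites
`1, …, p + 1` by a block tridiagonal matrix which is polynomial in `k`. Its determinant `Δ(k)` is
computed in two ways.

The columns of the Jost solution satisfy the boundary condition and are annihilated except at the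
first site, where `k f_0` is left over because `f_0` need not vanish. Replacing the last block
column by this relation leaves a triangular matrix up to a rotation of the columns, and gives
`Δ = det f_0 · ∏ det a_x`.

For `0 < |k| < 1`, the solution of `(H_o - λ(k)) y = z` with `z` supported on the sites
`1, …, p + 1` satisfies the boundary condition as well. Composing with the compression `G(k)` of
the free resolvent therefore gives `Δ(k) det G(k) = (-k)^{(p+1)d} D_c(k)`. For `V_c = 0` both `Δ`
and `D_c` are `1`, which determines `det G(k)`, whence `Δ = D_c`.

In the self-adjoint case the adjoint of the matrix at `k` is the matrix at the conjugate of `k`, so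
that `Δ` has real coefficients.
-/

noncomputable section

section BlockMatrices

variable {m R : Type*} [Fintype m] [DecidableEq m] [CommRing R]

theorem det_comp_of_blockTriangular_id {n : Type*} [Fintype n] [LinearOrder n]
    {M : Matrix n n (Matrix m m R)} (hM : M.BlockTriangular id) :
    (Matrix.comp n n m m R M).det = ∏ i, (M i i).det := by
  rw [hM.comp.det_fintype]
  refine Finset.prod_congr rfl fun i _ => ?_
  let e : m ≃ {x : n × m // id x.1 = i} :=
    { toFun := fun a => ⟨(i, a), rfl⟩
      invFun := fun x => x.1.2
      left_inv := fun _ => rfl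
      right_inv := by rintro ⟨⟨_, _⟩, rfl⟩; rfl }
  rw [← Matrix.det_submatrix_equiv_self e]
  rfl

theorem det_comp_submatrix_right {n : Type*} [Fintype n] [DecidableEq n]
    (M : Matrix n n (Matrix m m R)) (σ : Equiv.Perm n) :
    (Matrix.comp n n m m R (M.submatrix id σ)).det =
      (Equiv.Perm.sign σ : ℤ) ^ Fintype.card m * (Matrix.comp n n m m R M).det := by
  have hsign : Equiv.Perm.sign (Equiv.prodCongrLeft fun _ : m => σ) =
      Equiv.Perm.sign σ ^ Fintype.card m := by
    rw [Equiv.Perm.sign_prodCongrLeft, Finset.prod_const, Finset.card_univ]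
  have h := Matrix.det_permute' (Equiv.prodCongrLeft fun _ : m => σ) (Matrix.comp n n m m R M)
  rw [hsign] at h
  push_cast at h
  exact h

theorem det_comp_updateCol_one {n : ℕ} (g : Fin (n + 1) → Matrix m m R) :
    (Matrix.comp _ _ m m R ((1 : Matrix _ _ (Matrix m m R)).updateCol (Fin.last n) g)).det =
      (g (Fin.last n)).det := by
  rw [det_comp_of_blockTriangular_id, Fin.prod_univ_castSucc]
  · simp [Fin.castSucc_ne_last]
  · intro i j hij
    simp only [id_eq] at hij
    rw [Matrix.updateCol_ne (hij.trans_le (Fin.le_last i)).ne, Matrix.one_apply_ne hij.ne']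

theorem det_comp_updateCol_single_of_hessenberg {n : ℕ}
    {T : Matrix (Fin (n + 1)) (Fin (n + 1)) (Matrix m m R)}
    (hT : ∀ i j : Fin (n + 1), (j : ℕ) + 1 < i → T i j = 0) (h : Matrix m m R) :
    (Matrix.comp _ _ m m R (T.updateCol (Fin.last n) (Pi.single 0 h))).det =
      h.det * ∏ i : Fin n, (-T i.succ i.castSucc).det := by
  set M := T.updateCol (Fin.last n) (Pi.single 0 h) with hM
  have hzero : (finRotate (n + 1)).symm 0 = Fin.last n := by
    rw [Equiv.symm_apply_eq, finRotate_last]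
  have hsucc (j : Fin n) : (finRotate (n + 1)).symm j.succ = j.castSucc := by
    rw [Equiv.symm_apply_eq, finRotate_apply, Fin.coeSucc_eq_succ]
  have hfirst (i : Fin (n + 1)) : M i (Fin.last n) =
      (Pi.single 0 h : Fin (n + 1) → Matrix m m R) i := by
    rw [hM, Matrix.updateCol_self]
  have hother (i : Fin (n + 1)) (j : Fin n) : M i j.castSucc = T i j.castSucc := by
    rw [hM, Matrix.updateCol_ne (Fin.castSucc_ne_last j)]
  have hupper : (M.submatrix id (finRotate (n + 1)).symm).BlockTriangular id := by
    intro i j hij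
    rw [Matrix.submatrix_apply]
    cases j using Fin.cases with
    | zero => rw [hzero, hfirst, id, Pi.single_eq_of_ne (show i ≠ 0 from hij.ne')]
    | succ j => rw [hsucc, hother, id, hT i _ (by simpa [Fin.lt_def] using hij)]
  have hrot := det_comp_submatrix_right M (finRotate (n + 1)).symm
  rw [det_comp_of_blockTriangular_id hupper, Fin.prod_univ_succ, Equiv.Perm.sign_symm,
    sign_finRotate] at hrot
  simp only [Matrix.submatrix_apply, hzero, hsucc, hfirst, hother, id_eq,
    Pi.single_eq_same] at hrot
  simp only [Matrix.det_neg, Finset.prod_mul_distrib, Finset.prod_const, Finset.card_univ,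
    Fintype.card_fin]
  rw [mul_left_comm, hrot, ← mul_assoc, pow_right_comm, ← mul_pow]
  simp [← mul_pow]

theorem det_comp_mul_det_of_hessenberg {n : ℕ}
    {T : Matrix (Fin (n + 1)) (Fin (n + 1)) (Matrix m m R)}
    (hT : ∀ i j : Fin (n + 1), (j : ℕ) + 1 < i → T i j = 0)
    {g : Fin (n + 1) → Matrix m m R} {h : Matrix m m R} (hg : T.mulVec g = Pi.single 0 h) :
    (Matrix.comp _ _ m m R T).det * (g (Fin.last n)).det =
      h.det * ∏ i : Fin n, (-T i.succ i.castSucc).det := by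
  have hmul : T * (1 : Matrix _ _ _).updateCol (Fin.last n) g =
      T.updateCol (Fin.last n) (Pi.single 0 h) := by
    rw [Matrix.mul_updateCol, mul_one, hg]
  rw [← det_comp_updateCol_single_of_hessenberg hT, ← hmul, ← det_comp_updateCol_one g,
    ← Matrix.det_mul]
  exact congrArg Matrix.det (map_mul (Matrix.compRingEquiv _ _ R) _ _).symm

end BlockMatrices

section Tridiagonal

variable {R : Type*}

/-- The tridiagonal `n × n` matrix whose `i`-th row is `A i`, `B i`, `C i` in the columns
`i - 1`, `i`, `i + 1`, as far as these exist. -/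
def tridiagonal [Zero R] (n : ℕ) (A B C : ℕ → R) : Matrix (Fin n) (Fin n) R :=
  Matrix.of fun i j =>
    if (j : ℕ) + 1 = i then A i
    else if (j : ℕ) = i then B i
    else if (j : ℕ) = i + 1 then C i
    else 0

theorem sum_tridiagonal_smul [Ring R] {S : Type*} [AddCommGroup S] [Module R S] {n : ℕ}
    (A B C : ℕ → R) (F : ℕ → S) (i : Fin n) :
    ∑ j : Fin n, tridiagonal n A B C i j • F (j + 1) =
      (if (i : ℕ) = 0 then 0 else A i • F i) + B i • F (i + 1)
        + if (i : ℕ) + 1 < n then C i • F (i + 2) else 0 := by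
  have hsum (l : ℕ) (c : R) : ∑ j : Fin n, (if (j : ℕ) = l then c • F (j + 1) else 0) =
      if l < n then c • F (l + 1) else 0 := by
    rw [Fin.sum_univ_eq_sum_range (fun j => if j = l then c • F (j + 1) else 0),
      Finset.sum_ite_eq']
    simp only [Finset.mem_range]
  have hterm (j : Fin n) : tridiagonal n A B C i j • F (j + 1) =
      (if (i : ℕ) = 0 then 0 else if (j : ℕ) = i - 1 then A i • F (j + 1) else 0)
        + (if (j : ℕ) = i then B i • F (j + 1) else 0)
        + (if (j : ℕ) = i + 1 then C i • F (j + 1) else 0) := by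
    rw [tridiagonal, Matrix.of_apply]
    split_ifs <;> first | omega | simp
  simp only [hterm, Finset.sum_add_distrib, hsum, if_pos i.isLt]
  congr 2
  split_ifs with hi
  · exact Finset.sum_const_zero
  · rw [hsum, if_pos (by omega), Nat.sub_add_cancel (by omega)]

theorem conjTranspose_tridiagonal [AddMonoid R] [StarAddMonoid R] (n : ℕ) (A B C : ℕ → R) :
    (tridiagonal n A B C).conjTranspose =
      tridiagonal n (fun i => star (C (i - 1))) (fun i => star (B i))
        fun i => star (A (i + 1)) := by
  ext i j : 2
  simp only [tridiagonal, Matrix.conjTranspose_apply, Matrix.of_apply]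
  split_ifs <;> first | omega | exact star_zero R | (congr 2 <;> omega)

theorem map_tridiagonal [Zero R] {S F : Type*} [Zero S] [FunLike F R S] [ZeroHomClass F R S]
    (φ : F) (n : ℕ) (A B C : ℕ → R) :
    (tridiagonal n A B C).map φ =
      tridiagonal n (fun i => φ (A i)) (fun i => φ (B i)) fun i => φ (C i) := by
  ext i j
  simp only [tridiagonal, Matrix.map_apply, Matrix.of_apply, apply_ite φ, map_zero]

end Tridiagonal

theorem matrix_eq_of_eval {m n : Type*} {A B : Matrix m n ℂ[X]}
    (h : ∀ k : ℂ, k ≠ 0 → A.map (eval k) = B.map (eval k)) : A = B := by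
  ext1 i j
  refine eq_of_infinite_eval_eq _ _ ((Set.finite_singleton (0 : ℂ)).infinite_compl.mono ?_)
  exact fun k hk => congrFun₂ (h k hk) i j

namespace JacobiPerturbation

variable {d : ℕ} (V : JacobiPerturbation d)

/-- The perturbation lives on the sites `1, …, p`: this is the support condition in the class
`J_q^c`, without the invertibility conditions. -/
def SupportedIn (p : ℕ) : Prop := ∀ x, p < x → V.a x = 1 ∧ V.s x = 1 ∧ V.b x = 0

/-- The operator `H_o + V_c` is formally self-adjoint: the conditions of the class `J_q`, with the
positivity of the `a_x` weakened to `a_x = a_x^*`. -/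
structure IsSymmetric : Prop where
  a_eq_s : ∀ x, 1 ≤ x → V.a x = V.s x
  a_hermitian : ∀ x, 1 ≤ x → (V.a x).IsHermitian
  b_hermitian : ∀ x, 1 ≤ x → (V.b x).IsHermitian

variable {V} {p : ℕ}

section Pencil

variable {R : Type*} [CommRing R] [Algebra ℂ R]

variable (V p) in
/-- The matrix `-z (H_o + V_c - (z + z⁻¹))` on the sites `1, …, p + 1`, acting on restrictions of
sequences with `y_{p+2} = z y_{p+1}`. Clearing the denominator makes it polynomial in `z`, so that
`z` may be an element of any `ℂ`-algebra. The row `i` belongs to the site `i + 1`; the corner entry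
is `1 + z² - z²`, the last term coming from the boundary condition. -/
def pencil (z : R) : Matrix (Fin (p + 1)) (Fin (p + 1)) (Matrix (Fin d) (Fin d) R) :=
  tridiagonal (p + 1) (fun x => -(z • (V.a x).map (algebraMap ℂ R)))
    (fun x => if x = p then 1 else (1 + z ^ 2) • 1 - z • (V.b (x + 1)).map (algebraMap ℂ R))
    fun x => -(z • (V.s (x + 1)).map (algebraMap ℂ R))

theorem sum_pencil_smul {S : Type*} [AddCommGroup S] [Module R S]
    [Module (Matrix (Fin d) (Fin d) R) S] [IsScalarTower R (Matrix (Fin d) (Fin d) R) S]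
    (hV : V.SupportedIn p) (z : R) {F : ℕ → S} (hF : F (p + 2) = z • F (p + 1))
    (i : Fin (p + 1)) :
    ∑ j : Fin (p + 1), V.pencil p z i j • F (j + 1) =
      (1 + z ^ 2) • F (i + 1) - z • ((V.a i).map (algebraMap ℂ R) • F i
        + (V.s (i + 1)).map (algebraMap ℂ R) • F (i + 2)
        + (V.b (i + 1)).map (algebraMap ℂ R) • F (i + 1))
        + if (i : ℕ) = 0 then z • F 0 else 0 := by
  have hlast : (V.s (p + 1)).map (algebraMap ℂ R) = 1 ∧ (V.b (p + 1)).map (algebraMap ℂ R) = 0 := by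
    simp [(hV (p + 1) (by omega)).2]
  have hfirst : (V.a 0).map (algebraMap ℂ R) = 1 := by simp [V.a_zero]
  rw [pencil, sum_tridiagonal_smul]
  have hrow : (if (i : ℕ) = 0 then 0 else -(z • (V.a i).map (algebraMap ℂ R)) • F i) =
      -(z • (V.a i).map (algebraMap ℂ R) • F i) + if (i : ℕ) = 0 then z • F 0 else 0 := by
    split_ifs with hi
    · rw [hi, hfirst, one_smul, neg_add_cancel]
    · rw [neg_smul, smul_assoc, add_zero]
  rw [hrow]
  by_cases hi : (i : ℕ) = p
  · rw [if_pos hi, if_neg (by omega : ¬(i : ℕ) + 1 < p + 1), hi, hlast.1, hlast.2, hF]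
    simp only [one_smul, zero_smul, smul_zero, smul_add, add_smul, smul_smul, pow_two]
    abel
  · rw [if_neg hi, if_pos (by omega : (i : ℕ) + 1 < p + 1)]
    simp only [neg_smul, sub_smul, smul_assoc, one_smul, smul_add]
    abel

theorem map_pencil {S : Type*} [CommRing S] [Algebra ℂ S] (φ : R →ₐ[ℂ] S) (z : R) :
    (V.pencil p z).map φ.mapMatrix = V.pencil p (φ z) := by
  have hcoeff (M : Matrix (Fin d) (Fin d) ℂ) :
      φ.mapMatrix (M.map (algebraMap ℂ R)) = M.map (algebraMap ℂ S) := by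
    ext i j; simp
  have hsmul (r : R) (M : Matrix (Fin d) (Fin d) R) :
      φ.mapMatrix (r • M) = φ r • φ.mapMatrix M := by
    ext i j; simp
  simp only [pencil, map_tridiagonal, apply_ite, map_neg, map_sub, map_one, hsmul, hcoeff, map_add,
    map_pow]

theorem IsSymmetric.conjTranspose_pencil (hV : V.IsSymmetric) (k : ℂ) :
    (V.pencil p k).conjTranspose = V.pencil p (star k) := by
  rw [pencil, conjTranspose_tridiagonal]
  ext1 i j
  have hpred (h : (j : ℕ) + 1 = i) : (V.s (i - 1 + 1)).conjTranspose = V.a i := by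
    rw [Nat.sub_add_cancel (by omega), ← hV.a_eq_s i (by omega),
      (hV.a_hermitian i (by omega)).eq]
  have hsucc : (V.a (i + 1)).conjTranspose = V.s (i + 1) := by
    rw [(hV.a_hermitian _ (by omega)).eq, hV.a_eq_s _ (by omega)]
  simp only [pencil, tridiagonal, Matrix.of_apply, Algebra.algebraMap_self, RingHom.coe_id,
    Matrix.map_id, Matrix.star_eq_conjTranspose, Matrix.conjTranspose_neg,
    Matrix.conjTranspose_smul, hsucc]
  split_ifs with h h' h'
  · rw [hpred h]
  · exact Matrix.conjTranspose_one
  · simp [(hV.b_hermitian (i + 1) (by omega)).eq]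
  · rfl
  · rfl

end Pencil

variable (V p) in
/-- The determinant of the pencil as a polynomial in the spectral parameter: the polynomial
extension of the Fredholm determinant `D_c`. -/
def perturbationDet : ℂ[X] := (Matrix.comp _ _ _ _ ℂ[X] (V.pencil p X)).det

theorem eval_perturbationDet (k : ℂ) :
    (V.perturbationDet p).eval k = (Matrix.comp _ _ _ _ ℂ (V.pencil p k)).det := by
  rw [perturbationDet, ← coe_aeval_eq_eval, AlgHom.map_det]
  have h := map_pencil (V := V) (p := p) (aeval k) X
  rw [aeval_X] at h
  rw [← h]
  rfl

theorem isJostSolution_iff {f : ℕ → Matrix (Fin d) (Fin d) ℂ[X]} :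
    V.IsJostSolution p f ↔
      (∀ x, (X : ℂ[X]) • ((V.a x).map C * f x + (V.s (x + 1)).map C * f (x + 2)
        + (V.b (x + 1)).map C * f (x + 1)) = (1 + X ^ 2 : ℂ[X]) • f (x + 1)) ∧
      ∀ x, p < x → f x = (X ^ x : ℂ[X]) • (1 : Matrix (Fin d) (Fin d) ℂ[X]) := by
  have hC (k : ℂ) (M : Matrix (Fin d) (Fin d) ℂ) : (M.map C).map (eval k) = M := by
    ext; simp
  have hadd (k : ℂ) (M N : Matrix (Fin d) (Fin d) ℂ[X]) :
      (M + N).map (eval k) = M.map (eval k) + N.map (eval k) :=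
    map_add (evalRingHom k).mapMatrix M N
  have hmul (k : ℂ) (M N : Matrix (Fin d) (Fin d) ℂ[X]) :
      (M * N).map (eval k) = M.map (eval k) * N.map (eval k) :=
    map_mul (evalRingHom k).mapMatrix M N
  have hsmul (k : ℂ) (P : ℂ[X]) (M : Matrix (Fin d) (Fin d) ℂ[X]) :
      (P • M).map (eval k) = P.eval k • M.map (eval k) := by
    ext; simp
  have hone (k : ℂ) : (1 : Matrix (Fin d) (Fin d) ℂ[X]).map (eval k) = 1 :=
    map_one (evalRingHom k).mapMatrix
  have hlam {k : ℂ} (hk : k ≠ 0) {M N : Matrix (Fin d) (Fin d) ℂ} :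
      M = (k + k⁻¹) • N ↔ k • M = (1 + k ^ 2) • N := by
    rw [← smul_right_inj hk, smul_smul, show k * (k + k⁻¹) = 1 + k ^ 2 by field_simp; ring]
  constructor
  · rintro ⟨heq, hpow⟩
    refine ⟨fun x => matrix_eq_of_eval fun k hk => ?_, fun x hx => matrix_eq_of_eval fun k _ => ?_⟩
    · simpa [hadd, hmul, hsmul, hC] using (hlam hk).1 (heq k hk x)
    · simpa [hsmul, hone] using hpow x hx k
  · rintro ⟨heq, hpow⟩
    refine ⟨fun k hk x => (hlam hk).2 ?_, fun x hx k => ?_⟩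
    · simpa [hadd, hmul, hsmul, hC] using congrArg (·.map (eval k)) (heq x)
    · simp [hpow x hx, hsmul, hone]

theorem IsJostSolution.pencil_mulVec (hV : V.SupportedIn p) {f : ℕ → Matrix (Fin d) (Fin d) ℂ[X]}
    (hf : V.IsJostSolution p f) :
    (V.pencil p (X : ℂ[X])).mulVec (fun j => f (j + 1)) = Pi.single 0 ((X : ℂ[X]) • f 0) := by
  obtain ⟨hf, hpow⟩ := isJostSolution_iff.1 hf
  have hlast : f (p + 2) = (X : ℂ[X]) • f (p + 1) := by
    rw [hpow _ (by omega), hpow _ (by omega), smul_smul, ← pow_succ']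
  ext1 i
  have h := sum_pencil_smul hV X hlast i
  simp only [smul_eq_mul, algebraMap_eq] at h
  rw [Matrix.mulVec, dotProduct, h, hf, sub_self, zero_add, Pi.single_apply]
  exact if_congr Fin.val_eq_zero_iff rfl rfl

theorem IsJostSolution.perturbationDet_eq (hV : V.SupportedIn p)
    {f : ℕ → Matrix (Fin d) (Fin d) ℂ[X]} (hf : V.IsJostSolution p f) :
    V.perturbationDet p = (f 0).det * C (∏ j ∈ Finset.range p, (V.a (j + 1)).det) := by
  have hhess : ∀ i j : Fin (p + 1), (j : ℕ) + 1 < i → V.pencil p (X : ℂ[X]) i j = 0 := by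
    intro i j hij
    simp only [pencil, tridiagonal, Matrix.of_apply]
    rw [if_neg (by omega), if_neg (by omega), if_neg (by omega)]
  have hsub (i : Fin p) : (-V.pencil p (X : ℂ[X]) i.succ i.castSucc).det =
      X ^ d * C (V.a (i + 1)).det := by
    have hC : ((V.a (i + 1)).map C).det = C (V.a (i + 1)).det := (C.map_det _).symm
    simp [pencil, tridiagonal, hC]
  have hlast : (f (p + 1)).det = X ^ ((p + 1) * d) := by
    rw [(isJostSolution_iff.1 hf).2 _ (by omega)]
    simp [← pow_mul]
  have h := det_comp_mul_det_of_hessenberg hhess (hf.pencil_mulVec hV)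
  simp only [hsub, Fin.val_last, hlast, Matrix.det_smul, Fintype.card_fin,
    Finset.prod_mul_distrib, Finset.prod_const, Finset.card_univ] at h
  refine mul_right_cancel₀ (pow_ne_zero ((p + 1) * d) (X_ne_zero (R := ℂ))) (h.trans ?_)
  rw [Fin.prod_univ_eq_prod_range (fun j => C (V.a (j + 1)).det), map_prod]
  ring

section JostSolution

theorem IsJostSolution.unique (ha : ∀ x, (V.a x).det ≠ 0)
    {f g : ℕ → Matrix (Fin d) (Fin d) ℂ[X]} (hf : V.IsJostSolution p f)
    (hg : V.IsJostSolution p g) : f = g := by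
  obtain ⟨hf, hfpow⟩ := isJostSolution_iff.1 hf
  obtain ⟨hg, hgpow⟩ := isJostSolution_iff.1 hg
  have hcancel (x : ℕ) (h₁ : f (x + 1) = g (x + 1)) (h₂ : f (x + 2) = g (x + 2)) : f x = g x := by
    have h := (hf x).trans ((congrArg _ h₁).trans (hg x).symm)
    rw [h₁, h₂] at h
    have hunit : IsUnit ((V.a x).map C) :=
      ((Matrix.isUnit_iff_isUnit_det _).2 (ha x).isUnit).map C.mapMatrix
    exact hunit.mul_left_cancel (add_right_cancel (add_right_cancel
      (smul_right_injective _ X_ne_zero h)))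
  have hagree : ∀ n x, p < x + n → f x = g x := by
    intro n
    induction n with
    | zero => exact fun x hx => (hfpow x hx).trans (hgpow x hx).symm
    | succ n ih => exact fun x hx => hcancel x (ih _ (by omega)) (ih _ (by omega))
  exact funext fun x => hagree (p + 1) x (by omega)

variable (V p) in
/-- The matrix polynomials `g_x` for which `f_x(k) = k ^ x g_x(k)` is the Jost solution, obtained
by solving the equation downwards from `g_x = 1` for `x > p`. -/
def jostFactor (x : ℕ) : Matrix (Fin d) (Fin d) ℂ[X] :=
  if p < x then 1 else
    (V.a x)⁻¹.map C * ((1 + X ^ 2 : ℂ[X]) • jostFactor (x + 1)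
      - (X ^ 2 : ℂ[X]) • ((V.s (x + 1)).map C * jostFactor (x + 2))
      - (X : ℂ[X]) • ((V.b (x + 1)).map C * jostFactor (x + 1)))
termination_by p + 1 - x

theorem jostFactor_of_lt {x : ℕ} (hx : p < x) : V.jostFactor p x = 1 := by
  rw [jostFactor, if_pos hx]

theorem a_mul_jostFactor (ha : ∀ x, (V.a x).det ≠ 0) (hV : V.SupportedIn p) (x : ℕ) :
    (V.a x).map C * V.jostFactor p x = (1 + X ^ 2 : ℂ[X]) • V.jostFactor p (x + 1)
      - (X ^ 2 : ℂ[X]) • ((V.s (x + 1)).map C * V.jostFactor p (x + 2))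
      - (X : ℂ[X]) • ((V.b (x + 1)).map C * V.jostFactor p (x + 1)) := by
  by_cases hx : p < x
  · rw [jostFactor_of_lt hx, jostFactor_of_lt (by omega : p < x + 1),
      jostFactor_of_lt (by omega : p < x + 2), (hV x hx).1, (hV (x + 1) (by omega)).2.1,
      (hV (x + 1) (by omega)).2.2]
    simp [add_smul]
  · have hinv : (V.a x).map C * (V.a x)⁻¹.map C = 1 := by
      rw [← Matrix.map_mul, Matrix.mul_nonsing_inv _ (ha x).isUnit]
      simp
    rw [jostFactor, if_neg hx, ← mul_assoc, hinv, one_mul]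

theorem isJostSolution_jostFactor (ha : ∀ x, (V.a x).det ≠ 0) (hV : V.SupportedIn p) :
    V.IsJostSolution p fun x => (X ^ x : ℂ[X]) • V.jostFactor p x := by
  refine isJostSolution_iff.2 ⟨fun x => ?_, fun x hx => by rw [jostFactor_of_lt hx]⟩
  simp only [mul_smul_comm, a_mul_jostFactor ha hV]
  match_scalars <;> ring

theorem existsUnique_isJostSolution (ha : ∀ x, (V.a x).det ≠ 0) (hV : V.SupportedIn p) :
    ∃! f, V.IsJostSolution p f :=
  ⟨_, isJostSolution_jostFactor ha hV, fun _ hg => hg.unique ha (isJostSolution_jostFactor ha hV)⟩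

theorem det_invProd (p : ℕ) : (V.invProd p).det =
    (∏ j ∈ Finset.range p, (V.a (j + 1)).det)⁻¹ := by
  rw [invProd, ← Matrix.coe_detMonoidHom, map_list_prod, List.map_map, ← Finset.prod_inv_distrib,
    Finset.prod_eq_multiset_prod, Finset.range_val, Multiset.range, Multiset.map_coe,
    Multiset.prod_coe]
  simp only [Function.comp_def, Matrix.coe_detMonoidHom, Matrix.det_nonsing_inv,
    Ring.inverse_eq_inv']

theorem IsJostSolution.det_eval_eq (ha : ∀ x, (V.a x).det ≠ 0) (hV : V.SupportedIn p)
    {f : ℕ → Matrix (Fin d) (Fin d) ℂ[X]} (hf : V.IsJostSolution p f) (k : ℂ) :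
    (f 0).det.eval k = (V.perturbationDet p).eval k * (V.invProd p).det := by
  rw [hf.perturbationDet_eq hV, eval_mul, eval_C, det_invProd, mul_assoc,
    mul_inv_cancel₀ (Finset.prod_ne_zero_iff.2 fun j _ => ha (j + 1)), mul_one]

end JostSolution

section Conjugation

theorem IsSymmetric.star_eval_perturbationDet (hV : V.IsSymmetric) (k : ℂ) :
    star ((V.perturbationDet p).eval k) = (V.perturbationDet p).eval (star k) := by
  rw [eval_perturbationDet, eval_perturbationDet, ← hV.conjTranspose_pencil,
    ← Matrix.conjTranspose_comp', Matrix.det_conjTranspose]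

theorem IsSymmetric.star_det_invProd (hV : V.IsSymmetric) (p : ℕ) :
    star (V.invProd p).det = (V.invProd p).det := by
  rw [det_invProd, star_inv₀, star_prod]
  congr 1
  refine Finset.prod_congr rfl fun j _ => ?_
  rw [← Matrix.det_conjTranspose, (hV.a_hermitian _ (by omega)).eq]

theorem IsSymmetric.map_conj_det_jost (hV : V.IsSymmetric) (ha : ∀ x, (V.a x).det ≠ 0)
    (hp : V.SupportedIn p) {f : ℕ → Matrix (Fin d) (Fin d) ℂ[X]} (hf : V.IsJostSolution p f) :
    (f 0).det.map (starRingEnd ℂ) = (f 0).det := by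
  refine Polynomial.funext fun k => ?_
  have hconj := eval_map_apply (f := starRingEnd ℂ) (p := (f 0).det) (star k)
  rw [starRingEnd_apply, starRingEnd_apply, star_star] at hconj
  rw [hconj, hf.det_eval_eq ha hp, hf.det_eval_eq ha hp, star_mul', hV.star_eval_perturbationDet,
    hV.star_det_invProd, star_star]

end Conjugation

end JacobiPerturbation

section FiniteRank

theorem det_one_add_comp_comm {K M N : Type*} [Field K] [AddCommGroup M] [Module K M]
    [FiniteDimensional K M] [AddCommGroup N] [Module K N] [FiniteDimensional K N]
    (f : M →ₗ[K] N) (g : N →ₗ[K] M) :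
    LinearMap.det (1 + f ∘ₗ g) = LinearMap.det (1 + g ∘ₗ f) := by
  let b := Module.finBasis K M
  let c := Module.finBasis K N
  rw [← LinearMap.det_toMatrix c, ← LinearMap.det_toMatrix b, map_add, map_add,
    LinearMap.toMatrix_comp c b c, LinearMap.toMatrix_comp b c b, LinearMap.toMatrix_one,
    LinearMap.toMatrix_one, Matrix.det_one_add_mul_comm]

variable {E X : Type*} [NormedAddCommGroup E] [NormedSpace ℂ E] [AddCommGroup X] [Module ℂ X]
  [FiniteDimensional ℂ X] {A : E →L[ℂ] E} {J : X →ₗ[ℂ] E} {B : E →ₗ[ℂ] X}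

theorem finiteDimensional_range_of_eq_comp (hA : (A : E →ₗ[ℂ] E) = J ∘ₗ B) :
    FiniteDimensional ℂ (LinearMap.range (A : E →ₗ[ℂ] E)) :=
  Submodule.finiteDimensional_of_le (hA ▸ LinearMap.range_comp_le_range B J)

theorem fredholmDet_of_eq_comp (hA : (A : E →ₗ[ℂ] E) = J ∘ₗ B) :
    fredholmDet A = LinearMap.det (1 + B ∘ₗ J) := by
  have := finiteDimensional_range_of_eq_comp hA
  have hAx (x : E) : A x = J (B x) := LinearMap.congr_fun hA x
  let f : LinearMap.range B →ₗ[ℂ] LinearMap.range (A : E →ₗ[ℂ] E) :=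
    J.restrict (by rintro _ ⟨x, rfl⟩; exact ⟨x, hAx x⟩)
  let g : LinearMap.range (A : E →ₗ[ℂ] E) →ₗ[ℂ] LinearMap.range B :=
    B.restrict fun x _ => LinearMap.mem_range_self B x
  have hrange : (A : E →ₗ[ℂ] E).restrict (p := LinearMap.range (A : E →ₗ[ℂ] E))
      (q := LinearMap.range (A : E →ₗ[ℂ] E)) (fun x _ => LinearMap.mem_range_self _ x)
      = f ∘ₗ g := LinearMap.ext fun x => Subtype.ext (hAx x)
  have hcompress : g ∘ₗ f = (B.rangeRestrict ∘ₗ J) ∘ₗ (LinearMap.range B).subtype := rfl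
  rw [fredholmDet, hrange, det_one_add_comp_comm, hcompress, det_one_add_comp_comm]
  rfl

end FiniteRank

section FreeResolvent

theorem norm_shiftRight_le (d : ℕ) : ‖shiftRight d‖ ≤ 1 :=
  LinearMap.mkContinuous_norm_le _ zero_le_one _

theorem norm_shiftLeft_le (d : ℕ) : ‖shiftLeft d‖ ≤ 1 :=
  LinearMap.mkContinuous_norm_le _ zero_le_one _

theorem shiftLeft_mul_shiftRight (d : ℕ) : shiftLeft d * shiftRight d = 1 := rfl

variable {d : ℕ} {k : ℂ}

theorem freeOp_sub_eq (hk : k ≠ 0) :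
    freeOp d - (k + k⁻¹) • 1 = (-k⁻¹) • ((1 - k • shiftLeft d) * (1 - k • shiftRight d)) := by
  rw [sub_mul, one_mul, mul_sub, mul_one, smul_mul_smul_comm, shiftLeft_mul_shiftRight, freeOp]
  match_scalars <;> field_simp
  ring

theorem isUnit_one_sub_smul (hk : ‖k‖ < 1) {T : LatticeSpace d →L[ℂ] LatticeSpace d}
    (hT : ‖T‖ ≤ 1) : IsUnit (1 - k • T) := by
  have h : ‖k • T‖ < 1 := by
    rw [norm_smul]
    exact (mul_le_of_le_one_right (norm_nonneg _) hT).trans_lt hk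
  exact (Units.oneSub _ h).isUnit

theorem isUnit_freeOp_sub (hk : k ≠ 0) (hk1 : ‖k‖ < 1) :
    IsUnit (freeOp d - (k + k⁻¹) • 1) := by
  rw [freeOp_sub_eq hk]
  exact ((isUnit_one_sub_smul hk1 (norm_shiftLeft_le d)).mul
    (isUnit_one_sub_smul hk1 (norm_shiftRight_le d))).smul
      (Units.mk0 (-k⁻¹) (neg_ne_zero.2 (inv_ne_zero hk)))

theorem freeOp_sub_freeResolvent (hk : k ≠ 0) (hk1 : ‖k‖ < 1) (z : LatticeSpace d) :
    (freeOp d - (k + k⁻¹) • 1) (freeResolvent d k z) = z := by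
  rw [freeResolvent, if_neg hk]
  exact DFunLike.congr_fun (Ring.mul_inverse_cancel _ (isUnit_freeOp_sub hk hk1)) z

theorem siteValue_shiftLeft_pow (y : LatticeSpace d) (n x : ℕ) :
    siteValue ((shiftLeft d ^ n) y) (x + 1) = siteValue y (x + n + 1) := by
  induction n generalizing x with
  | zero => rfl
  | succ n ih =>
    rw [pow_succ']
    exact (ih (x + 1)).trans (congrArg (siteValue y) (by ring))

theorem siteValue_ext {y z : LatticeSpace d}
    (h : ∀ x, siteValue y (x + 1) = siteValue z (x + 1)) : y = z := by
  ext n : 2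
  exact h n

theorem siteValue_succ_of_freeOp_sub (hk : k ≠ 0) (hk1 : ‖k‖ < 1) {y : LatticeSpace d} {n : ℕ}
    (hy : ∀ x, n < x → siteValue ((freeOp d - (k + k⁻¹) • 1) y) x = 0) {x : ℕ} (hx : n ≤ x) :
    siteValue y (x + 1) = k • siteValue y x := by
  set L := shiftLeft d
  set u := (1 - k • shiftRight d) y
  have hz : (L ^ n) ((freeOp d - (k + k⁻¹) • 1) y) = 0 := siteValue_ext fun x => by
    rw [siteValue_shiftLeft_pow, hy _ (by omega)]
    rfl
  have hLu : (1 - k • L) ((L ^ n) u) = 0 := by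
    have hcomm : Commute (1 - k • L) (L ^ n) :=
      ((Commute.one_left L).sub_left ((Commute.refl L).smul_left k)).pow_right n
    rw [freeOp_sub_eq hk, smul_apply, map_smul, smul_eq_zero_iff_right
      (neg_ne_zero.2 (inv_ne_zero hk))] at hz
    exact (DFunLike.congr_fun hcomm.eq u).trans hz
  have hu : (L ^ n) u = 0 := by
    obtain ⟨T, hT⟩ := (isUnit_one_sub_smul hk1 (norm_shiftLeft_le d)).exists_left_inv
    have h : (L ^ n) u = T ((1 - k • L) ((L ^ n) u)) := (DFunLike.congr_fun hT _).symm
    rwa [hLu, map_zero] at h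
  obtain ⟨m, rfl⟩ := Nat.exists_eq_add_of_le' hx
  have h := siteValue_shiftLeft_pow u n m
  rw [hu] at h
  exact sub_eq_zero.1 h.symm

end FreeResolvent

section Truncation

variable {d p : ℕ}

theorem siteValue_sub (y z : LatticeSpace d) (x : ℕ) :
    siteValue (y - z) x = siteValue y x - siteValue z x := by
  rw [sub_eq_add_neg, ← neg_one_smul ℂ, siteValue_add, siteValue_smul, neg_one_smul, sub_eq_add_neg]

variable (d p) in
/-- The restriction of a sequence to the sites `1, …, p + 1`. -/
def siteRestrict : LatticeSpace d →ₗ[ℂ] (Fin (p + 1) × Fin d → ℂ) where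
  toFun y i := siteValue y (i.1 + 1) i.2
  map_add' y z := by ext i; simp [siteValue_add]
  map_smul' c y := by ext i; simp [siteValue_smul]

theorem siteRestrict_apply (y : LatticeSpace d) (i : Fin (p + 1)) (a : Fin d) :
    siteRestrict d p y (i, a) = siteValue y (i + 1) a := rfl

variable (d p) in
/-- The extension by zero from the sites `1, …, p + 1`. -/
def siteExtend : (Fin (p + 1) × Fin d → ℂ) →ₗ[ℂ] LatticeSpace d where
  toFun w := ⟨fun n => if h : n < p + 1 then WithLp.toLp 2 fun a => w (⟨n, h⟩, a) else 0,
    (memlp_two_iff _).2 (summable_of_ne_finset_zero (s := Finset.range (p + 1)) fun n hn => by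
      rw [dif_neg (by simpa using hn)]; simp)⟩
  map_add' v w := by
    ext n : 2
    rw [lp.coeFn_add, Pi.add_apply]
    dsimp only
    split_ifs with h
    · rfl
    · exact (add_zero _).symm
  map_smul' c w := by
    ext n : 2
    rw [lp.coeFn_smul, Pi.smul_apply]
    dsimp only
    split_ifs with h
    · rfl
    · exact (smul_zero c).symm

theorem siteValue_siteExtend (w : Fin (p + 1) × Fin d → ℂ) (n : ℕ) :
    siteValue (siteExtend d p w) (n + 1) =
      if h : n < p + 1 then WithLp.toLp 2 fun a => w (⟨n, h⟩, a) else 0 := rfl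

theorem siteRestrict_siteExtend (w : Fin (p + 1) × Fin d → ℂ) :
    siteRestrict d p (siteExtend d p w) = w := by
  ext ⟨i, a⟩
  rw [siteRestrict_apply, siteValue_siteExtend, dif_pos i.2]

theorem siteExtend_siteRestrict {y : LatticeSpace d} (hy : ∀ n, p < n → siteValue y (n + 1) = 0) :
    siteExtend d p (siteRestrict d p y) = y := by
  refine siteValue_ext fun n => ?_
  rw [siteValue_siteExtend]
  split_ifs with h
  · rfl
  · exact (hy n (by omega)).symm

variable (d p) in
/-- The compression of the free resolvent at `k + k⁻¹` to the sites `1, …, p + 1`. -/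
def compressedResolvent (k : ℂ) : (Fin (p + 1) × Fin d → ℂ) →ₗ[ℂ] (Fin (p + 1) × Fin d → ℂ) :=
  siteRestrict d p ∘ₗ (freeResolvent d k).toLinearMap ∘ₗ siteExtend d p

end Truncation

namespace JacobiPerturbation

variable {d : ℕ} {V : JacobiPerturbation d} {p : ℕ} {k : ℂ}

theorem siteExtend_siteRestrict_op (hV : V.SupportedIn p) (y : LatticeSpace d) :
    siteExtend d p (siteRestrict d p (V.op y)) = V.op y := by
  refine siteExtend_siteRestrict fun n hn => ?_
  rw [siteValue_op, (hV n hn).1, (hV (n + 1) (by omega)).2.1, (hV (n + 1) (by omega)).2.2]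
  simp

theorem op_comp_freeResolvent_eq (hV : V.SupportedIn p) (k : ℂ) :
    (V.op ∘L freeResolvent d k).toLinearMap =
      siteExtend d p ∘ₗ siteRestrict d p ∘ₗ (V.op ∘L freeResolvent d k).toLinearMap :=
  LinearMap.ext fun _ => (siteExtend_siteRestrict_op hV _).symm

theorem finiteDimensional_range_op_comp_freeResolvent (hV : V.SupportedIn p) (k : ℂ) :
    FiniteDimensional ℂ (LinearMap.range (V.op ∘L freeResolvent d k).toLinearMap) :=
  finiteDimensional_range_of_eq_comp (op_comp_freeResolvent_eq hV k)

theorem fredholmD_eq_det (hV : V.SupportedIn p) (k : ℂ) :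
    V.fredholmD k = LinearMap.det (1 + siteRestrict d p ∘ₗ
      (V.op ∘L freeResolvent d k).toLinearMap ∘ₗ siteExtend d p) :=
  (fredholmDet_of_eq_comp (op_comp_freeResolvent_eq hV k)).trans
    (by rw [LinearMap.comp_assoc])

open scoped Matrix.Module in
theorem pencil_mulVec_siteRestrict (hV : V.SupportedIn p) (hk : k ≠ 0) {y : LatticeSpace d}
    (hy : siteValue y (p + 2) = k • siteValue y (p + 1)) :
    (Matrix.comp _ _ _ _ ℂ (V.pencil p k)).mulVec (siteRestrict d p y) =
      -k • siteRestrict d p (V.op y + (freeOp d - (k + k⁻¹) • 1) y) := by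
  ext ⟨i, a⟩
  have hrow : (Matrix.comp _ _ _ _ ℂ (V.pencil p k)).mulVec (siteRestrict d p y) (i, a) =
      (∑ j : Fin (p + 1), V.pencil p k i j • (siteValue y (j + 1)).ofLp) a := by
    rw [Finset.sum_apply]
    exact Fintype.sum_prod_type _
  have h := sum_pencil_smul (F := fun x => (siteValue y x).ofLp) hV k
    (congrArg WithLp.ofLp hy) i
  have hzero : (if (i : ℕ) = 0 then k • (siteValue y 0).ofLp else 0) = 0 :=
    ite_eq_right_iff.2 fun _ => smul_zero k
  have hmul (M : Matrix (Fin d) (Fin d) ℂ) (v : Fin d → ℂ) : M • v = M.mulVec v := rfl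
  rw [hrow, h, hzero, add_zero, Pi.smul_apply, siteRestrict_apply, siteValue_add, siteValue_op,
    sub_apply, siteValue_sub, siteValue_freeOp, smul_apply, siteValue_smul,
    one_apply_eq_self]
  simp only [Algebra.algebraMap_self, RingHom.coe_id, Matrix.map_id, hmul, smul_add, Pi.sub_apply,
    Pi.smul_apply, smul_eq_mul, Pi.add_apply, map_sub, Matrix.toLpLin_one, LinearMap.sub_apply,
    LinearMap.id_coe, id_eq, PiLp.add_apply, PiLp.sub_apply, Matrix.ofLp_toLpLin,
    Matrix.toLin'_apply, PiLp.smul_apply, neg_mul]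
  field_simp
  ring

theorem toLin'_pencil_comp_compressedResolvent (hV : V.SupportedIn p) (hk : k ≠ 0)
    (hk1 : ‖k‖ < 1) :
    Matrix.toLin' (Matrix.comp _ _ _ _ ℂ (V.pencil p k)) ∘ₗ compressedResolvent d p k =
      -k • (1 + siteRestrict d p ∘ₗ (V.op ∘L freeResolvent d k).toLinearMap ∘ₗ siteExtend d p) := by
  refine LinearMap.ext fun w => ?_
  have hdecay := siteValue_succ_of_freeOp_sub hk hk1 (n := p + 1) (x := p + 1)
    (y := freeResolvent d k (siteExtend d p w)) (fun x hx => ?_) le_rfl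
  · refine (pencil_mulVec_siteRestrict hV hk hdecay).trans ?_
    rw [freeOp_sub_freeResolvent hk hk1, map_add, siteRestrict_siteExtend]
    exact congrArg _ (add_comm _ _)
  · obtain ⟨n, rfl⟩ := Nat.exists_eq_add_of_lt hx
    rw [freeOp_sub_freeResolvent hk hk1, siteValue_siteExtend, dif_neg (by omega)]

theorem eval_perturbationDet_mul_det_compressedResolvent (hV : V.SupportedIn p) (hk : k ≠ 0)
    (hk1 : ‖k‖ < 1) :
    (V.perturbationDet p).eval k * LinearMap.det (compressedResolvent d p k) =
      (-k) ^ ((p + 1) * d) * V.fredholmD k := by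
  rw [eval_perturbationDet, ← LinearMap.det_toLin', ← LinearMap.det_comp,
    toLin'_pencil_comp_compressedResolvent hV hk hk1, LinearMap.det_smul, fredholmD_eq_det hV]
  simp

variable (d) in
/-- The zero perturbation, for which `H_o + V_c = H_o`. -/
def free : JacobiPerturbation d := ⟨fun _ => 1, fun _ => 1, fun _ => 0, rfl, 0, by simp⟩

theorem supportedIn_free (p : ℕ) : (free d).SupportedIn p := fun _ _ => ⟨rfl, rfl, rfl⟩

theorem isJostSolution_free (p : ℕ) :
    (free d).IsJostSolution p fun x => (X ^ x : ℂ[X]) • 1 := by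
  refine isJostSolution_iff.2 ⟨fun x => ?_, fun x _ => rfl⟩
  simp only [free, Matrix.map_one, Matrix.map_zero, map_one, map_zero, one_mul, zero_mul, add_zero]
  match_scalars
  ring

theorem perturbationDet_free (p : ℕ) : (free d).perturbationDet p = 1 := by
  rw [(isJostSolution_free p).perturbationDet_eq (supportedIn_free p)]
  simp [free]

theorem fredholmD_free (k : ℂ) : (free d).fredholmD k = 1 := by
  have hop : (free d).op = 0 := by
    ext1 y
    exact siteValue_ext fun x => by rw [siteValue_op]; simp [free, siteValue]
  rw [fredholmD_eq_det (supportedIn_free 0), hop]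
  simp

theorem det_compressedResolvent (p : ℕ) (hk : k ≠ 0) (hk1 : ‖k‖ < 1) :
    LinearMap.det (compressedResolvent d p k) = (-k) ^ ((p + 1) * d) := by
  simpa [perturbationDet_free, fredholmD_free] using
    eval_perturbationDet_mul_det_compressedResolvent (supportedIn_free (d := d) p) hk hk1

theorem eval_zero_perturbationDet (p : ℕ) : (V.perturbationDet p).eval 0 = 1 := by
  have hpencil : V.pencil p (0 : ℂ) = 1 := by
    ext1 i j
    simp only [pencil, tridiagonal, Matrix.of_apply, Matrix.one_apply, zero_smul, neg_zero,
      sub_zero, zero_pow two_ne_zero, add_zero, one_smul, ite_self, Fin.ext_iff]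
    grind
  rw [eval_perturbationDet, hpencil]
  exact (congrArg Matrix.det (map_one (Matrix.compRingEquiv (Fin (p + 1)) (Fin d) ℂ))).trans
    Matrix.det_one

theorem eval_perturbationDet_eq_fredholmD (hV : V.SupportedIn p) (hk1 : ‖k‖ < 1) :
    (V.perturbationDet p).eval k = V.fredholmD k := by
  obtain rfl | hk := eq_or_ne k 0
  · rw [eval_zero_perturbationDet, fredholmD_eq_det hV, freeResolvent, if_pos rfl]
    simp
  · have h := eval_perturbationDet_mul_det_compressedResolvent hV hk hk1
    rw [det_compressedResolvent p hk hk1, mul_comm] at h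
    exact mul_left_cancel₀ (pow_ne_zero _ (neg_ne_zero.2 hk)) h

end JacobiPerturbation

section ConjInvariant

variable {φ : ℂ[X]} (hφ : φ.map (starRingEnd ℂ) = φ)
include hφ

theorem eval_conj_of_map_conj_eq (k : ℂ) :
    φ.eval (starRingEnd ℂ k) = starRingEnd ℂ (φ.eval k) := by
  rw [← eval_map_apply, hφ]

theorem im_eval_ofReal_of_map_conj_eq (t : ℝ) : (φ.eval (t : ℂ)).im = 0 := by
  have h := eval_conj_of_map_conj_eq hφ t
  rw [Complex.conj_ofReal] at h
  exact Complex.conj_eq_iff_im.1 h.symm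

theorem isResonance_conj_iff (k : ℂ) : IsResonance φ (starRingEnd ℂ k) ↔ IsResonance φ k := by
  have hfix {c : ℂ} (hc : starRingEnd ℂ c = c) : starRingEnd ℂ k = c ↔ k = c :=
    (starRingEnd ℂ).injective.eq_iff' hc
  rw [IsResonance, IsResonance, eval_conj_of_map_conj_eq hφ, map_eq_zero, RCLike.norm_conj,
    hfix (map_one _), hfix (by simp)]

theorem rootMultiplicity_conj (k : ℂ) :
    φ.rootMultiplicity (starRingEnd ℂ k) = φ.rootMultiplicity k := by
  have h := eq_rootMultiplicity_map (p := φ) (starRingEnd ℂ).injective k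
  rw [hφ] at h
  exact h.symm

end ConjInvariant

namespace JacobiPerturbation

variable {d p q : ℕ} {V : JacobiPerturbation d}

theorem MemJc.det_a_ne_zero (hV : V.MemJc p q) (x : ℕ) : (V.a x).det ≠ 0 := by
  cases x with
  | zero => simp [V.a_zero]
  | succ x => exact hV.det_a _ (by omega)

open scoped ComplexOrder in
theorem MemJ.isSymmetric (hV : V.MemJ p q) : V.IsSymmetric :=
  ⟨hV.a_eq_s, fun x hx => (hV.a_posDef x hx).isHermitian, hV.b_hermitian⟩

end JacobiPerturbation

theorem theorem1p2_general {d p : ℕ} (V : JacobiPerturbation d) (ha : ∀ x, (V.a x).det ≠ 0)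
    (hV : V.SupportedIn p) :
    (∀ k : ℂ, k ≠ 0 → ‖k‖ < 1 →
      IsUnit (freeOp d - (k + k⁻¹) • 1) ∧
      FiniteDimensional ℂ
        (LinearMap.range (V.op ∘L freeResolvent d k : LatticeSpace d →ₗ[ℂ] LatticeSpace d))) ∧
    (∃! f, V.IsJostSolution p f) ∧
    ∀ f, V.IsJostSolution p f →
      (∀ k : ℂ, ‖k‖ < 1 → (f 0).det.eval k = V.fredholmD k * (V.invProd p).det) ∧
      (∃ P : ℂ[X], (∀ k : ℂ, ‖k‖ < 1 → P.eval k = V.fredholmD k) ∧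
        ∀ k : ℂ, (f 0).det.eval k = P.eval k * (V.invProd p).det) ∧
      (V.IsSymmetric →
        (∀ t : ℝ, ((f 0).det.eval (t : ℂ)).im = 0) ∧
        ∀ k : ℂ,
          (IsResonance (f 0).det k ↔ IsResonance (f 0).det (starRingEnd ℂ k)) ∧
          (f 0).det.rootMultiplicity k = (f 0).det.rootMultiplicity (starRingEnd ℂ k)) := by
  have hD : ∀ k : ℂ, ‖k‖ < 1 → (V.perturbationDet p).eval k = V.fredholmD k :=
    fun k hk1 => V.eval_perturbationDet_eq_fredholmD hV hk1
  refine ⟨fun k hk hk1 => ⟨isUnit_freeOp_sub hk hk1,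
    V.finiteDimensional_range_op_comp_freeResolvent hV k⟩, V.existsUnique_isJostSolution ha hV,
    fun f hf => ⟨fun k hk1 => ?_, ⟨V.perturbationDet p, hD, hf.det_eval_eq ha hV⟩, fun hsymm => ?_⟩⟩
  · rw [hf.det_eval_eq ha hV, hD k hk1]
  · have hconj := hsymm.map_conj_det_jost ha hV hf
    exact ⟨im_eval_ofReal_of_map_conj_eq hconj, fun k =>
      ⟨(isResonance_conj_iff hconj k).symm, (rootMultiplicity_conj hconj k).symm⟩⟩

end

theorem theorem1p2 (d p q : ℕ) (hd : 1 ≤ d) (hp : 1 ≤ p) (hq : q + 1 = 2 * p ∨ q = 2 * p)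
    (V : JacobiPerturbation d) (hV : V.MemJc p q) :
    (∀ k : ℂ, k ≠ 0 → ‖k‖ < 1 →
      IsUnit (freeOp d - (k + k⁻¹) • 1) ∧
      FiniteDimensional ℂ
        (LinearMap.range (V.op ∘L freeResolvent d k : LatticeSpace d →ₗ[ℂ] LatticeSpace d))) ∧
    (∃! f, V.IsJostSolution p f) ∧
    ∀ f, V.IsJostSolution p f →
      (∀ k : ℂ, ‖k‖ < 1 → (f 0).det.eval k = V.fredholmD k * (V.invProd p).det) ∧
      (∃ P : ℂ[X], (∀ k : ℂ, ‖k‖ < 1 → P.eval k = V.fredholmD k) ∧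
        ∀ k : ℂ, (f 0).det.eval k = P.eval k * (V.invProd p).det) ∧
      (V.MemJ p q →
        (∀ t : ℝ, ((f 0).det.eval (t : ℂ)).im = 0) ∧
        ∀ k : ℂ,
          (IsResonance (f 0).det k ↔ IsResonance (f 0).det (starRingEnd ℂ k)) ∧
          (f 0).det.rootMultiplicity k = (f 0).det.rootMultiplicity (starRingEnd ℂ k)) := by
  obtain ⟨hfree, hjost, hdet⟩ := theorem1p2_general V hV.det_a_ne_zero hV.support
  exact ⟨hfree, hjost, fun f hf =>
    (hdet f hf).imp_right (And.imp_right fun hsymm hJ => hsymm hJ.isSymmetric)⟩
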